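/- Let $T>1$ and $N\ge 1$ be integers, write $\mathbb Z[1,T]=\{1,\dots,T\}$, let $|\cdot|$ and $(\cdot,\cdot)$ be the Euclidean norm and inner product of $\mathbb R^N$, and let $\Delta u(t)=u(t+1)-u(t)$. Consider the system, for $t\in\mathbb Z$, $$\begin{cases}\mu\Delta\big[\rho_1(t-1)\phi_1(\Delta u_1(t-1))\big]-\mu\rho_3(t)\phi_3(u_1(t))+\nabla_{u_1}W(t,u_1(t),u_2(t))=0,\\ \mu\Delta\big[\rho_2(t-1)\phi_2(\Delta u_2(t-1))\big]-\mu\rho_4(t)\phi_4(u_2(t))+\nabla_{u_2}W(t,u_1(t),u_2(t))=0,\end{cases}\tag{1}$$ where $W=F-\lambda G+\nu H$. Suppose that: * $(\rho)$ $\rho_i:\mathbb Z\to\mathbb R$ is $T$-periodic and $\min_{t\in\mathbb Z[1,T]}\rho_i(t)>0$, $i=1,2,3,4$; * $(\mathcal A1)$ $\phi_i:\mathbb R^N\to\mathbb R^N$ is a homeomorphism with $\phi_i(0)=0$ and $\phi_i=\nabla\Phi_i$, where $\Phi_i\in C^1(\mathbb R^N,[0,+\infty))$ is strictly convex and $\Phi_i(0)=0$,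 $i=1,2,3,4$; * $(\mathcal A2)$ $F,G,H:\mathbb Z\times\mathbb R^N\times\mathbb R^N\to\mathbb R$ are $T$-periodic in $t$ and continuously differentiable in $(x_1,x_2)$ for every $t\in\mathbb Z[1,T]$; * $(\mathcal A3)$ there are $c_i>0$ $(i=1,2,3,4)$ and $\theta>1$ such that $(\phi_i(x)-\phi_i(y),x-y)\ge c_i|x-y|^\theta$ for all $x,y\in\mathbb R^N$; * $(\mathcal A4)$ $\lim_{|x|\to\infty}\Phi_i(x)=+\infty$, and there are $l\ge\theta$ and $d_i,m_i>0$ such that $\Phi_i(x)\le d_i|x|^l+m_i$ for all $x\in\mathbb R^N$, $i=1,2,3,4$; * $(\mathcal A5)'$ there is $s>l$ such that for every $t\in\mathbb Z[1,T]$ $$\lim_{|x_1|+|x_2|\to\infty}\frac{F(t,x_1,x_2)}{|x_1|^l+|x_2|^l}=+\infty,\qquad \limsup_{|x_1|+|x_2|\to\infty}\frac{F(t,x_1,x_2)}{|x_1|^s+|x_2|^s}<+\infty,\qquad \lim_{|x_1|+|x_2|\to\infty}\frac{G(t,x_1,x_2)}{|x_1|^s+|x_2|^s}=+\infty;$$ *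 $(\mathcal A6)$ $\sum_{t=1}^TG(t,0,0)=0$. Let $E_T$ be the space of $T$-periodic sequences $h:\mathbb Z\to\mathbb R^N$ with the norm $\|h\|_{E_T}=\big(\sum_{t=1}^T|\Delta h(t)|^\theta+\sum_{t=1}^T|h(t)|^\theta\big)^{1/\theta}$, and let $E=E_T\times E_T$ with $\|u\|=\|u_1\|_{E_T}+\|u_2\|_{E_T}$ for $u=(u_1,u_2)$. For $u\in E$ put $$I(u)=\sum_{t=1}^T\big[\rho_1(t)\Phi_1(\Delta u_1(t))+\rho_2(t)\Phi_2(\Delta u_2(t))+\rho_3(t)\Phi_3(u_1(t))+\rho_4(t)\Phi_4(u_2(t))\big],$$ $$\Psi(u)=-\sum_{t=1}^TF(t,u_1(t),u_2(t)),\qquad \Phi(u)=\sum_{t=1}^TG(t,u_1(t),u_2(t)),$$ and for $r>0$ and $\mu>0$ put $$\beta(\mu I+\Psi,\Phi,r)=\sup_{u\in\Phi^{-1}(]r,+\infty[)}\frac{\mu I(u)+\Psi(u)-\inf_{\Phi^{-1}(]-\infty,r])}(\mu I+\Psi)}{r-\Phi(u)},$$ $$\mu^*(I,\Psi,\Phi,r)=\inf\Big\{\frac{\Psi(u)-\gamma+r}{\eta_r-I(u)}:u\in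 E,\ \Phi(u)<r,\ I(u)<\eta_r\Big\},\qquad \gamma=\inf_E(\Psi+\Phi),\qquad \eta_r=\inf_{\Phi^{-1}(r)}I.$$ Then for each $r>0$, each $\mu>\max\{0,\mu^*(I,\Psi,\Phi,r)\}$ and each compact interval $[a,b]\subset\,]0,\beta(\mu I+\Psi,\Phi,r)[$ there exists $R>0$ with the following property: for every $\lambda\in[a,b]$ there exists $\delta>0$ such that for each $\nu\in[0,\delta]$ system (1) has at least three distinct $T$-periodic solutions in $E$ whose norms are less than $R$. -/

import Mathlib

noncomputable section

namespace DiffSystem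

open Filter

/-- `ℝ^N` with the Euclidean norm and inner product. -/
abbrev Vec (N : ℕ) : Type := EuclideanSpace ℝ (Fin N)

/-- The space `E_T` of `T`-periodic sequences `ℤ → ℝ^N`. -/
def ET (N T : ℕ) : Submodule ℝ (ℤ → Vec N) where
  carrier := {h | ∀ t : ℤ, h (t + T) = h t}
  add_mem' := by
    intro a b ha hb t
    simp only [Pi.add_apply]
    rw [ha t, hb t]
  zero_mem' := by
    intro t
    rfl
  smul_mem' := by
    intro c a ha t
    simp only [Pi.smul_apply]
    rw [ha t]

/-- The space `E = E_T × E_T`. -/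
abbrev E (N T : ℕ) : Type := ET N T × ET N T

/-- The first component of `u ∈ E`, as a sequence. -/
def E.fst {N T : ℕ} (u : E N T) : ℤ → Vec N := (u.1 : ℤ → Vec N)

/-- The second component of `u ∈ E`, as a sequence. -/
def E.snd {N T : ℕ} (u : E N T) : ℤ → Vec N := (u.2 : ℤ → Vec N)

/-- The forward difference `Δ h (t) = h (t + 1) - h t`. -/
def delta {N : ℕ} (h : ℤ → Vec N) (t : ℤ) : Vec N := h (t + 1) - h t

/-- The norm `‖h‖ = (∑_{t=1}^T |Δ h(t)|^θ + ∑_{t=1}^T |h(t)|^θ)^{1/θ}` of `E_T`. -/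
def normET {N : ℕ} (T : ℕ) (θ : ℝ) (h : ℤ → Vec N) : ℝ :=
  (∑ t ∈ Finset.Icc (1 : ℤ) T, ‖delta h t‖ ^ θ + ∑ t ∈ Finset.Icc (1 : ℤ) T, ‖h t‖ ^ θ) ^ (1 / θ)

/-- The norm `‖u‖ = ‖u₁‖ + ‖u₂‖` of `E`. -/
def normE {N T : ℕ} (θ : ℝ) (u : E N T) : ℝ :=
  normET T θ (E.fst u) + normET T θ (E.snd u)

/-- The functional `I`. The indices `0, 1, 2, 3` stand for `1, 2, 3, 4`. -/
def funI {N T : ℕ} (ρ : Fin 4 → ℤ → ℝ) (Φ : Fin 4 → Vec N → ℝ) (u : E N T) : ℝ :=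
  ∑ t ∈ Finset.Icc (1 : ℤ) T,
    (ρ 0 t * Φ 0 (delta (E.fst u) t) + ρ 1 t * Φ 1 (delta (E.snd u) t)
      + ρ 2 t * Φ 2 (E.fst u t) + ρ 3 t * Φ 3 (E.snd u t))

/-- The functional `u ↦ ∑_{t=1}^T K(t, u₁(t), u₂(t))`. -/
def sumFun {N T : ℕ} (K : ℤ → Vec N → Vec N → ℝ) (u : E N T) : ℝ :=
  ∑ t ∈ Finset.Icc (1 : ℤ) T, K t (E.fst u t) (E.snd u t)

/-- The functional `Ψ(u) = -∑_{t=1}^T F(t, u₁(t), u₂(t))`. -/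
def funPsi {N T : ℕ} (F : ℤ → Vec N → Vec N → ℝ) (u : E N T) : ℝ := -sumFun F u

/-- The functional `Φ(u) = ∑_{t=1}^T G(t, u₁(t), u₂(t))`. -/
def funPhi {N T : ℕ} (G : ℤ → Vec N → Vec N → ℝ) (u : E N T) : ℝ := sumFun G u

/-- `β(J, Φ, r)`: the supremum over `Φ(u) > r` of `(J(u) - inf_{Φ ≤ r} J) / (r - Φ(u))`,
taken in the extended reals. -/
def beta {X : Type*} (J Φ : X → ℝ) (r : ℝ) : EReal :=
  ⨆ u ∈ {u : X | r < Φ u}, (((J u - sInf (J '' {v : X | Φ v ≤ r})) / (r - Φ u) : ℝ) : EReal)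

/-- `γ = inf (Ψ + Φ)`. -/
def gammaInf {X : Type*} (Ψ Φ : X → ℝ) : ℝ := sInf (Set.range fun u : X => Ψ u + Φ u)

/-- `η_r`: the infimum of `I` over the level set `Φ = r`. -/
def etaInf {X : Type*} (I Φ : X → ℝ) (r : ℝ) : ℝ := sInf (I '' {u : X | Φ u = r})

/-- `μ*(I, Ψ, Φ, r)`: the infimum of `(Ψ(u) - γ + r) / (η_r - I(u))` over all `u` with
`Φ(u) < r` and `I(u) < η_r`, taken in the extended reals. -/
def muStar {X : Type*} (I Ψ Φ : X → ℝ) (r : ℝ) : EReal :=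
  ⨅ u ∈ {u : X | Φ u < r ∧ I u < etaInf I Φ r},
    (((Ψ u - gammaInf Ψ Φ + r) / (etaInf I Φ r - I u) : ℝ) : EReal)

/-- The potential `W = F - λ G + ν H`. -/
def potW {N : ℕ} (F G H : ℤ → Vec N → Vec N → ℝ) (lam nu : ℝ) (t : ℤ) (x₁ x₂ : Vec N) : ℝ :=
  F t x₁ x₂ - lam * G t x₁ x₂ + nu * H t x₁ x₂

/-- `u` solves the difference system with potential `W` and parameter `μ` at every `t ∈ ℤ`. -/
def IsSolution {N T : ℕ} (mu : ℝ) (ρ : Fin 4 → ℤ → ℝ) (φ : Fin 4 → Vec N → Vec N)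
    (W : ℤ → Vec N → Vec N → ℝ) (u : E N T) : Prop :=
  ∀ t : ℤ,
    mu • delta (fun τ => ρ 0 (τ - 1) • φ 0 (delta (E.fst u) (τ - 1))) t
        - (mu * ρ 2 t) • φ 2 (E.fst u t)
        + gradient (fun x => W t x (E.snd u t)) (E.fst u t) = 0 ∧
    mu • delta (fun τ => ρ 1 (τ - 1) • φ 1 (delta (E.snd u) (τ - 1))) t
        - (mu * ρ 3 t) • φ 3 (E.snd u t)
        + gradient (fun x => W t (E.fst u t) x) (E.snd u t) = 0

/-- The filter expressing `|x₁| + |x₂| → ∞`. -/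
def pairInfty (N : ℕ) : Filter (Vec N × Vec N) :=
  comap (fun p : Vec N × Vec N => ‖p.1‖ + ‖p.2‖) atTop

/-- `K : ℤ × ℝ^N × ℝ^N → ℝ` is `T`-periodic in `t`, and `C¹` in `(x₁, x₂)` for `t ∈ ℤ[1,T]`. -/
def IsPeriodicC1 {N : ℕ} (T : ℕ) (K : ℤ → Vec N → Vec N → ℝ) : Prop :=
  (∀ (t : ℤ) (x₁ x₂ : Vec N), K (t + T) x₁ x₂ = K t x₁ x₂) ∧
  ∀ t ∈ Finset.Icc (1 : ℤ) T, ContDiff ℝ 1 (fun p : Vec N × Vec N => K t p.1 p.2)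

/-- `φ` is a homeomorphism of `ℝ^N` with `φ(0) = 0` and `φ = ∇Φ`, where
`Φ ∈ C¹(ℝ^N, [0, ∞))` is strictly convex and `Φ(0) = 0`. -/
structure IsClassicalHomeo {N : ℕ} (φ : Vec N → Vec N) (Φ : Vec N → ℝ) : Prop where
  homeo : IsHomeomorph φ
  map_zero : φ 0 = 0
  grad : ∀ x, HasGradientAt Φ (φ x) x
  contDiff : ContDiff ℝ 1 Φ
  nonneg : ∀ x, 0 ≤ Φ x
  strictConvex : StrictConvexOn ℝ Set.univ Φ
  zero : Φ 0 = 0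

end DiffSystem

end

open Filter Topology Bornology

/-! Write `P` for `funPhi G`, `J` for `μ I + Ψ`, and `S` for the sum of `H` over one period. By
summation by parts, critical points of `J + λ P - ν S` solve the system (`isSolution_of_critical`).
The space is finite-dimensional and `J + λ P` is coercive for `λ > 0`, as `I ≥ 0` and `G` outgrows
`F`.

The condition on `μ*` gives `u₀` in `P < r` with `J u₀ < κ`, where `κ` bounds `J` from below on `P =
r`. The condition on `β` gives `u₁` in `P > r` with `J u₁ + b P u₁ < m + b r`, where `m = inf_{P ≤
r} J`; this persists when `b` is lowered to `λ`. Hence `max κ m + λ r` is a barrier on `P = r`,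
above the values at `u₀` and `u₁`. Minimising on either side gives two local minima, and a mountain
pass between them gives a third critical point (`exists_three_critical_points_of_barrier`).

`exists_bound_three_critical_points` makes the bound uniform in `λ` and absorbs the perturbation:
`H` is cut off outside a large ball, hence uniformly small for small `ν`, and the three points lie
where the cutoff is 1. -/

theorem bounded_sublevel_of_tendsto_cobounded {X : Type*} [NormedAddCommGroup X] {f : X → ℝ}
    (hco : Tendsto f (cobounded X) atTop) (c : ℝ) :
    ∃ R : ℝ, 0 < R ∧ ∀ x, f x ≤ c → ‖x‖ < R := by
  have h := hco.eventually_gt_atTop c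
  rw [← comap_norm_atTop, eventually_comap] at h
  obtain ⟨R, hR⟩ := eventually_atTop.1 h
  refine ⟨max R 1, by positivity, fun x hx => ?_⟩
  by_contra! hcon
  exact absurd (hR ‖x‖ ((le_max_left _ _).trans hcon) x rfl) (not_lt.2 hx)

theorem exists_isMinOn_of_tendsto_cobounded {X : Type*} [NormedAddCommGroup X] [ProperSpace X]
    {f : X → ℝ} (hf : Continuous f) (hco : Tendsto f (cobounded X) atTop) {s : Set X}
    (hs : IsClosed s) {x₀ : X} (hx₀ : x₀ ∈ s) : ∃ x ∈ s, ∀ y ∈ s, f x ≤ f y := by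
  refine hf.continuousOn.exists_isMinOn' hs hx₀ ?_
  rw [← Metric.cobounded_eq_cocompact]
  exact (hco.eventually_ge_atTop (f x₀)).filter_mono inf_le_left

/-! ### Deformation by one gradient step, and the mountain pass -/

section MountainPass

variable {X : Type*} [NormedAddCommGroup X] [InnerProductSpace ℝ X] [FiniteDimensional ℝ X]

theorem continuous_gradient_of_contDiff {f : X → ℝ} (hf : ContDiff ℝ 1 f) :
    Continuous (gradient f) :=
  (InnerProductSpace.toDual ℝ X).symm.continuous.comp (hf.continuous_fderiv one_ne_zero)

theorem norm_gradient_sub_gradient (f : X → ℝ) (x y : X) :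
    ‖gradient f x - gradient f y‖ = ‖fderiv ℝ f x - fderiv ℝ f y‖ := by
  rw [gradient, gradient, ← map_sub, LinearIsometryEquiv.norm_map]

/-- Near a level without critical points the gradient is bounded away from zero. -/
theorem exists_gradient_lower_bound {f : X → ℝ} (hf : ContDiff ℝ 1 f)
    (hco : Tendsto f (cobounded X) atTop) {c : ℝ} (hc : ∀ x, f x = c → gradient f x ≠ 0) :
    ∃ ε > 0, ε ≤ 1 ∧ ∃ σ > 0, ∀ x, |f x - c| ≤ ε → σ ≤ ‖gradient f x‖ := by
  have : ProperSpace X := FiniteDimensional.proper ℝ X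
  obtain ⟨R, -, hR⟩ := bounded_sublevel_of_tendsto_cobounded hco (c + 1)
  -- This sum vanishes only at a critical point of level `c`, so it has a positive lower bound `m`
  -- on a ball containing `f ≤ c + 1`. If `|f x - c| ≤ m / 2`, the gradient carries the other half.
  have hcont : Continuous fun x => |f x - c| + ‖gradient f x‖ :=
    ((hf.continuous.sub continuous_const).abs).add (continuous_gradient_of_contDiff hf).norm
  obtain ⟨m, hm, hmle⟩ := (isCompact_closedBall (0 : X) R).exists_forall_le' hcont.continuousOn
    (a := 0) (fun x _ => by
      rcases eq_or_ne (f x) c with h | h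
      · exact add_pos_of_nonneg_of_pos (abs_nonneg _) (norm_pos_iff.2 (hc x h))
      · exact add_pos_of_pos_of_nonneg (abs_pos.2 (sub_ne_zero.2 h)) (norm_nonneg _))
  refine ⟨min 1 (m / 2), by positivity, min_le_left _ _, m / 2, by positivity, fun x hx => ?_⟩
  have h1 : f x ≤ c + 1 := by
    have := (abs_le.1 (hx.trans (min_le_left _ _))).2
    linarith
  have h2 := hmle x (by simpa using (hR x h1).le)
  have h3 := hx.trans (min_le_right _ _)
  linarith

/-- An explicit Euler step of the negative gradient decreases `f` as expected, up to an error
that is uniform on sublevel sets. -/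
theorem exists_euler_step_estimate {f : X → ℝ} (hf : ContDiff ℝ 1 f)
    (hco : Tendsto f (cobounded X) atTop) (c : ℝ) {ω : ℝ} (hω : 0 < ω) :
    ∃ τ₀ > 0, ∀ τ, 0 < τ → τ ≤ τ₀ → ∀ x, f x ≤ c →
      f (x - τ • gradient f x) ≤ f x - τ * ‖gradient f x‖ ^ 2 + τ * ‖gradient f x‖ * ω := by
  have : ProperSpace X := FiniteDimensional.proper ℝ X
  have hg := continuous_gradient_of_contDiff hf
  obtain ⟨R, -, hR⟩ := bounded_sublevel_of_tendsto_cobounded hco c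
  obtain ⟨M, hM⟩ := (isCompact_closedBall (0 : X) R).exists_bound_of_continuousOn
    hg.continuousOn
  obtain ⟨d, hd, hdω⟩ := Metric.uniformContinuousOn_iff_le.1
    ((isCompact_closedBall (0 : X) (R + |M|)).uniformContinuousOn_of_continuous hg.continuousOn)
    ω hω
  -- `τ ≤ 1` keeps the step inside the ball of radius `R + |M|`; `τ |M| ≤ d` keeps the gradient
  -- within `ω` of its initial value along it.
  refine ⟨min 1 (d / (|M| + 1)), by positivity, fun τ hτ hττ x hx => ?_⟩
  have hxR := (hR x hx).le
  have hgM : ‖gradient f x‖ ≤ |M| := (hM x (by simpa using hxR)).trans (le_abs_self M)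
  have hτ1 : τ ≤ 1 := hττ.trans (min_le_left _ _)
  have hτd : τ * |M| ≤ d := by
    have h1 : τ * (|M| + 1) ≤ d := (le_div_iff₀ (by positivity)).1 (hττ.trans (min_le_right _ _))
    linarith
  have hstep : ‖τ • gradient f x‖ = τ * ‖gradient f x‖ := by
    rw [norm_smul, Real.norm_of_nonneg hτ.le]
  have hsmall : τ * ‖gradient f x‖ ≤ τ * |M| := by gcongr
  have hsmall' : τ * ‖gradient f x‖ ≤ |M| := by
    nlinarith [norm_nonneg (gradient f x), abs_nonneg M]
  have key := (convex_closedBall x (τ * ‖gradient f x‖)).norm_image_sub_le_of_norm_fderiv_le'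
    (𝕜 := ℝ) (f := f) (φ := fderiv ℝ f x) (C := ω) (x := x) (y := x - τ • gradient f x)
    (fun z _ => (hf.differentiable one_ne_zero) z)
    (fun z hz => by
      rw [← norm_gradient_sub_gradient, ← dist_eq_norm]
      have hz' : dist z x ≤ τ * ‖gradient f x‖ := hz
      have hzR : ‖z‖ ≤ R + |M| := by
        have h1 : ‖z‖ ≤ ‖x‖ + ‖z - x‖ := by simpa using norm_add_le x (z - x)
        rw [dist_eq_norm] at hz'
        linarith
      exact hdω z (by simpa using hzR) x (by simpa using hxR.trans (by linarith [abs_nonneg M]))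
        (hz'.trans (hsmall.trans hτd)))
    (by simp; positivity) (by simp [hstep])
  have hder : fderiv ℝ f x (x - τ • gradient f x - x) = - (τ * ‖gradient f x‖ ^ 2) := by
    have h1 : fderiv ℝ f x = InnerProductSpace.toDual ℝ X (gradient f x) := by simp [gradient]
    rw [h1, sub_sub_cancel_left, InnerProductSpace.toDual_apply_apply, inner_neg_right,
      real_inner_smul_right, real_inner_self_eq_norm_sq]
  have hn : ‖x - τ • gradient f x - x‖ = τ * ‖gradient f x‖ := by
    rw [sub_sub_cancel_left, norm_neg, hstep]
  rw [hder, hn, Real.norm_eq_abs] at key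
  have := (abs_le.1 key).2
  linarith

/-- Deformation across a level without critical points, fixing all critical points. -/
theorem exists_deformation {f : X → ℝ} (hf : ContDiff ℝ 1 f)
    (hco : Tendsto f (cobounded X) atTop) {c : ℝ} (hc : ∀ x, f x = c → gradient f x ≠ 0) :
    ∃ ε > 0, ∃ η : X → X, Continuous η ∧ (∀ x, gradient f x = 0 → η x = x) ∧
      ∀ x, f x ≤ c + ε → f (η x) ≤ c - ε := by
  obtain ⟨ε₀, hε₀, hε₁, σ, hσ, hlow⟩ := exists_gradient_lower_bound hf hco hc
  obtain ⟨τ₀, hτ₀, hstep⟩ := exists_euler_step_estimate hf hco (c + 1) (half_pos hσ)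
  obtain ⟨τ, hτ, hττ₀, hτε⟩ : ∃ τ > 0, τ ≤ τ₀ ∧ τ * σ ^ 2 ≤ ε₀ / 2 :=
    ⟨min τ₀ (ε₀ / 2 / σ ^ 2), by positivity, min_le_left _ _,
      (le_div_iff₀ (by positivity)).1 (min_le_right _ _)⟩
  have hpos : 0 < τ * σ ^ 2 := by positivity
  -- With `ω = σ / 2`, a step from a point with `g ≥ σ` lowers `f` by at least `τ σ² / 2`, twice
  -- this `ε`. Below `c - ε₀` a step may raise `f`, but by at most `τ σ² / 4 ≤ ε₀ / 8`.
  refine ⟨τ * σ ^ 2 / 4, by positivity, fun x => x - τ • gradient f x,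
    continuous_id.sub ((continuous_gradient_of_contDiff hf).const_smul τ),
    fun x hx => by simp [hx], fun x hx => ?_⟩
  have h := hstep τ hτ hττ₀ x (by linarith)
  set g := ‖gradient f x‖
  have hg : 0 ≤ g := norm_nonneg _
  by_cases hx' : c - ε₀ ≤ f x
  · have hσg : σ ≤ g := hlow x (abs_le.2 ⟨by linarith, by linarith⟩)
    have h1 : σ ^ 2 / 2 ≤ g ^ 2 - g * (σ / 2) := by nlinarith
    have h2 := mul_le_mul_of_nonneg_left h1 hτ.le
    linarith
  · have h1 : -(σ ^ 2 / 4) ≤ g ^ 2 - g * (σ / 2) := by nlinarith [sq_nonneg (g - σ / 4)]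
    have h2 := mul_le_mul_of_nonneg_left h1 hτ.le
    push Not at hx'
    linarith

/-- Mountain pass theorem for coercive `C¹` functions on a finite-dimensional space, between two
critical points separated by a set on which `f` is at least `B`. -/
theorem exists_mountain_pass_point {f : X → ℝ} (hf : ContDiff ℝ 1 f)
    (hco : Tendsto f (cobounded X) atTop) {a b : X} (ha : gradient f a = 0)
    (hb : gradient f b = 0) {B C : ℝ}
    (hsep : ∀ γ : Path a b, ∃ t, B ≤ f (γ t)) (hC : ∀ x ∈ segment ℝ a b, f x ≤ C) :
    ∃ x, gradient f x = 0 ∧ B ≤ f x ∧ f x ≤ C := by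
  -- The infimum of `A` is the minimax level; were it free of critical points, the deformation would
  -- put a smaller level into `A`.
  set A : Set ℝ := {c | JoinedIn {x | f x ≤ c} a b} with hA
  have hCA : C ∈ A := JoinedIn.of_segment_subset hC
  have hBA : ∀ c ∈ A, B ≤ c := by
    rintro c ⟨γ, hγ⟩
    obtain ⟨t, ht⟩ := hsep γ
    exact ht.trans (hγ t)
  have hbdd : BddBelow A := ⟨B, hBA⟩
  by_contra! hcon
  have hBc : B ≤ sInf A := le_csInf ⟨C, hCA⟩ hBA
  have hcC : sInf A ≤ C := csInf_le hbdd hCA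
  obtain ⟨ε, hε, η, hη, hfix, hdec⟩ := exists_deformation hf hco (c := sInf A)
    (fun x hx h0 => absurd (hcon x h0 (hx ▸ hBc)) (not_lt.2 (hx ▸ hcC)))
  obtain ⟨c, hcA, hc⟩ := exists_lt_of_csInf_lt ⟨C, hCA⟩ (lt_add_of_pos_right (sInf A) hε)
  obtain ⟨γ, hγ⟩ := hcA
  have hmem : sInf A - ε ∈ A := by
    refine ⟨(γ.map hη).cast (hfix a ha).symm (hfix b hb).symm, fun t => ?_⟩
    exact hdec _ ((hγ t).trans hc.le)
  linarith [csInf_le hbdd hmem]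

end MountainPass

theorem injective_vec_three {α : Type*} {x y z : α} (hxy : x ≠ y) (hxz : x ≠ z) (hyz : y ≠ z) :
    Function.Injective ![x, y, z] := by
  intro i j hij
  fin_cases i <;> fin_cases j <;> simp_all

/-! ### Three critical points from a barrier, and stability under perturbation -/

section ThreeCriticalPoints

variable {X : Type*} [NormedAddCommGroup X] [InnerProductSpace ℝ X] [FiniteDimensional ℝ X]

theorem gradient_eq_zero_of_isLocalMin {f : X → ℝ} {x : X} (h : IsLocalMin f x) :
    gradient f x = 0 := by
  rw [gradient, h.fderiv_eq_zero, map_zero]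

/-- A coercive `C¹` function whose values on the level set `P = r` exceed some value attained in
`P < r` and some value attained in `P > r` has three critical points. -/
theorem exists_three_critical_points_of_barrier {f P : X → ℝ} (hf : ContDiff ℝ 1 f)
    (hP : Continuous P) (hco : Tendsto f (cobounded X) atTop) {r B : ℝ}
    (hB : ∀ x, P x = r → B ≤ f x) {u₀ u₁ : X} (hu₀ : P u₀ < r) (hu₁ : r < P u₁)
    (hfu₀ : f u₀ < B) (hfu₁ : f u₁ < B) :
    ∃ v₀ v₁ v₂ : X, gradient f v₀ = 0 ∧ gradient f v₁ = 0 ∧ gradient f v₂ = 0 ∧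
      v₀ ≠ v₁ ∧ v₀ ≠ v₂ ∧ v₁ ≠ v₂ ∧ f v₀ ≤ f u₀ ∧ f v₁ ≤ f u₁ ∧
      ∀ C, (∀ x ∈ segment ℝ v₀ v₁, f x ≤ C) → f v₂ ≤ C := by
  have : ProperSpace X := FiniteDimensional.proper ℝ X
  obtain ⟨v₀, hv₀, hmin₀⟩ := exists_isMinOn_of_tendsto_cobounded hf.continuous hco
    (isClosed_le hP continuous_const) (show u₀ ∈ {x | P x ≤ r} from hu₀.le)
  obtain ⟨v₁, hv₁, hmin₁⟩ := exists_isMinOn_of_tendsto_cobounded hf.continuous hco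
    (isClosed_le continuous_const hP) (show u₁ ∈ {x | r ≤ P x} from hu₁.le)
  have h₀ : f v₀ ≤ f u₀ := hmin₀ u₀ hu₀.le
  have h₁ : f v₁ ≤ f u₁ := hmin₁ u₁ hu₁.le
  -- The barrier keeps both constrained minimisers off `P = r`, so they are unconstrained local
  -- minima.
  have hv₀' : P v₀ < r := lt_of_le_of_ne hv₀ fun h => by linarith [hB v₀ h]
  have hv₁' : r < P v₁ := lt_of_le_of_ne hv₁ fun h => by linarith [hB v₁ h.symm]
  have hg₀ : gradient f v₀ = 0 := gradient_eq_zero_of_isLocalMin <|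
    (hP.tendsto v₀).eventually (gt_mem_nhds hv₀') |>.mono fun x hx => hmin₀ x (le_of_lt hx)
  have hg₁ : gradient f v₁ = 0 := gradient_eq_zero_of_isLocalMin <|
    (hP.tendsto v₁).eventually (lt_mem_nhds hv₁') |>.mono fun x hx => hmin₁ x (le_of_lt hx)
  obtain ⟨C, hC, hCle⟩ : ∃ C, (∀ x ∈ segment ℝ v₀ v₁, f x ≤ C) ∧
      ∀ C', (∀ x ∈ segment ℝ v₀ v₁, f x ≤ C') → C ≤ C' := by
    have hcomp : IsCompact (segment ℝ v₀ v₁) := by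
      rw [segment_eq_image_lineMap]
      exact isCompact_Icc.image AffineMap.lineMap_continuous
    obtain ⟨z, hz, hmax⟩ := hcomp.exists_isMaxOn ⟨v₀, left_mem_segment ℝ v₀ v₁⟩
      hf.continuous.continuousOn
    exact ⟨f z, fun x hx => hmax hx, fun C' h => h z hz⟩
  obtain ⟨v₂, hg₂, hBv₂, hCv₂⟩ := exists_mountain_pass_point hf hco hg₀ hg₁ (B := B)
    (fun γ => by
      obtain ⟨t, ht⟩ : r ∈ Set.range (P ∘ γ) :=
        mem_range_of_exists_le_of_exists_ge (hP.comp γ.continuous)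
          ⟨0, by simpa using hv₀⟩ ⟨1, by simpa using hv₁⟩
      exact ⟨t, hB _ ht⟩) hC
  refine ⟨v₀, v₁, v₂, hg₀, hg₁, hg₂, ?_, ?_, ?_, h₀, h₁, fun C' h => hCv₂.trans (hCle C' h)⟩
  -- The minima lie on different sides of `P = r`; the third point has value at least `B`, which
  -- both minima stay below.
  · rintro rfl; linarith
  · rintro rfl; linarith
  · rintro rfl; linarith

/-- A three critical points theorem with locally uniform bounds, stable under arbitrary small
`C¹` perturbations. -/
theorem exists_bound_three_critical_points {J P K : X → ℝ} (hJ : ContDiff ℝ 1 J)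
    (hP : ContDiff ℝ 1 P) (hK : ContDiff ℝ 1 K) {a b r κ m : ℝ} (ha : 0 < a)
    (hcoa : Tendsto (fun x => J x + a * P x) (cobounded X) atTop)
    (hcob : Tendsto (fun x => J x + b * P x) (cobounded X) atTop)
    (hκ : ∀ x, P x = r → κ ≤ J x) (hm : ∀ x, P x ≤ r → m ≤ J x)
    {u₀ u₁ : X} (hu₀ : P u₀ < r) (hJu₀ : J u₀ < κ) (hu₁ : r < P u₁)
    (hJu₁ : J u₁ + b * P u₁ < m + b * r) :
    ∃ R : ℝ, 0 < R ∧ ∀ lam ∈ Set.Icc a b, ∃ δ : ℝ, 0 < δ ∧ ∀ nu ∈ Set.Icc 0 δ,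
      ∃ u : Fin 3 → X, Function.Injective u ∧
        ∀ k, gradient (fun x => J x + lam * P x + nu * K x) (u k) = 0 ∧ ‖u k‖ < R := by
  have : ProperSpace X := FiniteDimensional.proper ℝ X
  -- `J + λ P` is affine in `λ`, so `g` is a coercive minorant for all `λ` in `[a, b]` at once.
  set g : X → ℝ := fun x => min (J x + a * P x) (J x + b * P x) with hg
  have hgco : Tendsto g (cobounded X) atTop := by
    rw [tendsto_atTop] at hcoa hcob ⊢
    intro c
    filter_upwards [hcoa c, hcob c] with x h1 h2 using le_min h1 h2
  have hgle : ∀ lam ∈ Set.Icc a b, ∀ x, g x ≤ J x + lam * P x := by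
    rintro lam ⟨h1, h2⟩ x
    rcases le_total 0 (P x) with h | h
    · exact (min_le_left _ _).trans (by nlinarith)
    · exact (min_le_right _ _).trans (by nlinarith)
  have hupper : ∀ lam ∈ Set.Icc a b, ∀ x, J x + lam * P x ≤ |J x| + b * |P x| := by
    rintro lam ⟨h1, h2⟩ x
    have h3 : lam * P x ≤ b * |P x| :=
      (mul_le_mul_of_nonneg_left (le_abs_self _) (ha.le.trans h1)).trans
        (mul_le_mul_of_nonneg_right h2 (abs_nonneg _))
    linarith [le_abs_self (J x)]
  have hQ : Continuous fun x => |J x| + b * |P x| :=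
    hJ.continuous.abs.add (continuous_const.mul hP.continuous.abs)
  -- `R₁` confines the two minima and `R₂` the mountain pass point, whose value is controlled by the
  -- maximum on a segment inside the `R₁`-ball. The margin 2 pays twice for a perturbation of size
  -- at most `ε ≤ 1`.
  set C₀ := max (|J u₀| + b * |P u₀|) (|J u₁| + b * |P u₁|) with hC₀
  obtain ⟨R₁, hR₁, hR₁g⟩ := bounded_sublevel_of_tendsto_cobounded hgco (C₀ + 2)
  obtain ⟨C₁, hC₁⟩ := (isCompact_closedBall (0 : X) R₁).exists_bound_of_continuousOn
    hQ.continuousOn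
  obtain ⟨R₂, hR₂, hR₂g⟩ := bounded_sublevel_of_tendsto_cobounded hgco (C₁ + 2)
  set R := max R₁ R₂ with hR
  have hRpos : 0 < R := lt_max_of_lt_left hR₁
  let χ : ContDiffBump (0 : X) := ⟨R, R + 1, hRpos, by linarith⟩
  have hχK : ContDiff ℝ 1 fun x => χ x * K x := χ.contDiff.mul hK
  obtain ⟨M, hM⟩ : ∃ M, ∀ x, ‖χ x * K x‖ ≤ M :=
    hχK.continuous.bounded_above_of_compact_support χ.hasCompactSupport.mul_right
  have hM0 : 0 ≤ M := (norm_nonneg _).trans (hM 0)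
  refine ⟨R, hRpos, fun lam hlam => ?_⟩
  have hlam0 : 0 < lam := ha.trans_le hlam.1
  set B := max κ m + lam * r with hB
  have hBle : ∀ x, P x = r → B ≤ J x + lam * P x := fun x hx => by
    rw [hB, hx]
    gcongr
    exact max_le (hκ x hx) (hm x hx.le)
  have hB₀ : J u₀ + lam * P u₀ < B := by
    have := le_max_left κ m
    nlinarith
  -- Passing from `b` to `λ` subtracts `(b - λ) P u₁` on the left and only `(b - λ) r` on the right.
  have hB₁ : J u₁ + lam * P u₁ < B := by
    have := le_max_right κ m
    nlinarith [hlam.2]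
  obtain ⟨ε, hε, hε1, hε₀, hε₁⟩ : ∃ ε > 0, ε ≤ 1 ∧ J u₀ + lam * P u₀ + ε < B - ε ∧
      J u₁ + lam * P u₁ + ε < B - ε := by
    refine ⟨min 1 (min ((B - (J u₀ + lam * P u₀)) / 3) ((B - (J u₁ + lam * P u₁)) / 3)),
      lt_min one_pos (lt_min (by linarith) (by linarith)), min_le_left _ _, ?_, ?_⟩
    · have h := (min_le_right (1 : ℝ) _).trans (min_le_left ((B - (J u₀ + lam * P u₀)) / 3)
        ((B - (J u₁ + lam * P u₁)) / 3))
      linarith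
    · have h := (min_le_right (1 : ℝ) _).trans (min_le_right ((B - (J u₀ + lam * P u₀)) / 3)
        ((B - (J u₁ + lam * P u₁)) / 3))
      linarith
  refine ⟨ε / (M + 1), by positivity, fun nu hnu => ?_⟩
  have hpert : ∀ x, |nu * (χ x * K x)| ≤ ε := fun x => by
    have h1 := (le_div_iff₀ (by positivity)).1 hnu.2
    have h2 : |χ x * K x| ≤ M := hM x
    rw [abs_mul, abs_of_nonneg hnu.1]
    nlinarith [hnu.1]
  set f : X → ℝ := fun x => J x + lam * P x + nu * (χ x * K x) with hf_def
  have hf : ContDiff ℝ 1 f :=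
    (hJ.add (contDiff_const.mul hP)).add (contDiff_const.mul hχK)
  have hlow : ∀ x, J x + lam * P x - ε ≤ f x := fun x => by
    have := (abs_le.1 (hpert x)).1
    simp only [hf_def]; linarith
  have hup : ∀ x, f x ≤ J x + lam * P x + ε := fun x => by
    have := (abs_le.1 (hpert x)).2
    simp only [hf_def]; linarith
  have hfco : Tendsto f (cobounded X) atTop :=
    tendsto_atTop_mono (fun x => by linarith [hlow x, hgle lam hlam x])
      (tendsto_atTop_add_const_right _ (-ε) hgco)
  obtain ⟨v₀, v₁, v₂, hv₀, hv₁, hv₂, h01, h02, h12, hf₀, hf₁, hf₂⟩ :=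
    exists_three_critical_points_of_barrier hf hP.continuous hfco (r := r) (B := B - ε)
      (fun x hx => by linarith [hBle x hx, hlow x]) hu₀ hu₁
      ((hup u₀).trans_lt hε₀) ((hup u₁).trans_lt hε₁)
  have hgf : ∀ x, g x ≤ f x + 1 := fun x => by linarith [hlow x, hgle lam hlam x]
  have hn₀ : ‖v₀‖ < R₁ := hR₁g v₀ (by
    linarith [hgf v₀, hup u₀, hupper lam hlam u₀, le_max_left (|J u₀| + b * |P u₀|)
      (|J u₁| + b * |P u₁|)])
  have hn₁ : ‖v₁‖ < R₁ := hR₁g v₁ (by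
    linarith [hgf v₁, hup u₁, hupper lam hlam u₁, le_max_right (|J u₀| + b * |P u₀|)
      (|J u₁| + b * |P u₁|)])
  have hn₂ : ‖v₂‖ < R₂ := hR₂g v₂ (by
    have h := hf₂ (C₁ + 1) (fun x hx => by
      have hx' : x ∈ Metric.closedBall (0 : X) R₁ :=
        (convex_closedBall (0 : X) R₁).segment_subset (by simpa using hn₀.le)
          (by simpa using hn₁.le) hx
      linarith [hup x, hupper lam hlam x, (le_abs_self _).trans (hC₁ x hx')])
    linarith [hgf v₂])
  have htransfer : ∀ x, ‖x‖ < R → gradient f x = 0 →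
      gradient (fun x => J x + lam * P x + nu * K x) x = 0 := fun x hx hgrad => by
    rw [← hgrad, gradient, gradient]
    -- The cutoff equals 1 on a neighbourhood of `x`, so both functions have the same derivative
    -- there.
    congr 1
    refine EventuallyEq.fderiv_eq ?_
    filter_upwards [χ.eventuallyEq_one_of_mem_ball (show x ∈ Metric.ball (0 : X) R by
      simpa using hx)] with y hy
    simp [hf_def, hy]
  refine ⟨![v₀, v₁, v₂], ?_, ?_⟩
  · exact injective_vec_three h01 h02 h12
  · have h₁ := le_max_left R₁ R₂
    have h₂ := le_max_right R₁ R₂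
    intro k
    fin_cases k
    · exact ⟨htransfer _ (hn₀.trans_le h₁) hv₀, hn₀.trans_le h₁⟩
    · exact ⟨htransfer _ (hn₁.trans_le h₁) hv₁, hn₁.trans_le h₁⟩
    · exact ⟨htransfer _ (hn₂.trans_le h₂) hv₂, hn₂.trans_le h₂⟩

end ThreeCriticalPoints

/-! ### Coercivity of sums over coordinates -/

theorem tendsto_cobounded_atTop_of_bounded_sublevel {X : Type*} [NormedAddCommGroup X] {f : X → ℝ}
    (h : ∀ c : ℝ, ∃ R : ℝ, ∀ x, f x ≤ c → ‖x‖ ≤ R) : Tendsto f (cobounded X) atTop := by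
  refine tendsto_atTop.2 fun c => ?_
  obtain ⟨R, hR⟩ := h c
  filter_upwards [tendsto_norm_cobounded_atTop.eventually_gt_atTop R] with x hx
  by_contra! hcon
  exact absurd (hR x hcon.le) (not_le.2 hx)

theorem exists_forall_le_of_tendsto_cobounded {X : Type*} [NormedAddCommGroup X] [ProperSpace X]
    {f : X → ℝ} (hf : Continuous f) (hco : Tendsto f (cobounded X) atTop) :
    ∃ c, ∀ x, c ≤ f x := by
  obtain ⟨x, -, hx⟩ := exists_isMinOn_of_tendsto_cobounded hf hco isClosed_univ (Set.mem_univ 0)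
  exact ⟨f x, fun y => hx y (Set.mem_univ y)⟩

/-- A finite sum of coercive continuous functions of the coordinates is coercive. -/
theorem tendsto_sum_pi_cobounded {ι Y : Type*} [Fintype ι] [NormedAddCommGroup Y] [ProperSpace Y]
    {k : ι → Y → ℝ} (hk : ∀ i, Continuous (k i))
    (hco : ∀ i, Tendsto (k i) (cobounded Y) atTop) :
    Tendsto (fun y : ι → Y => ∑ i, k i (y i)) (cobounded (ι → Y)) atTop := by
  classical
  choose m hm using fun i => exists_forall_le_of_tendsto_cobounded (hk i) (hco i)
  refine tendsto_cobounded_atTop_of_bounded_sublevel fun c => ?_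
  -- If the sum is at most `c`, each term is at most `c` minus the lower bounds of the others.
  choose R hR0 hR using fun i => bounded_sublevel_of_tendsto_cobounded (hco i)
    (c - ∑ j ∈ Finset.univ.erase i, m j)
  refine ⟨∑ i, R i, fun y hy => ?_⟩
  refine (pi_norm_le_iff_of_nonneg (Finset.sum_nonneg fun i _ => (hR0 i).le)).2 fun i => ?_
  refine (hR i (y i) ?_).le.trans
    (Finset.single_le_sum (fun j _ => (hR0 j).le) (Finset.mem_univ i))
  rw [← Finset.add_sum_erase _ _ (Finset.mem_univ i)] at hy
  have := Finset.sum_le_sum fun j (_ : j ∈ Finset.univ.erase i) => hm j (y j)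
  linarith

theorem LinearMap.tendsto_cobounded_of_injective {X Y : Type*} [NormedAddCommGroup X]
    [NormedSpace ℝ X] [FiniteDimensional ℝ X] [NormedAddCommGroup Y] [NormedSpace ℝ Y]
    (L : X →ₗ[ℝ] Y) (hL : Function.Injective L) : Tendsto L (cobounded X) (cobounded Y) := by
  obtain ⟨K, -, hK⟩ := L.exists_antilipschitzWith (LinearMap.ker_eq_bot.2 hL)
  exact hK.tendsto_cobounded

namespace DiffSystem

/-! ### Periodic sequences and the Euler–Lagrange equations -/

theorem forall_of_forall_mem_Icc {T : ℕ} (hT : 0 < T) {Q : ℤ → Prop}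
    (hper : ∀ t, Q (t + T) ↔ Q t) (h : ∀ t ∈ Finset.Icc (1 : ℤ) T, Q t) (t : ℤ) : Q t := by
  have hQ : Function.Periodic Q (T : ℤ) := fun t => propext (hper t)
  obtain ⟨y, hy, hty⟩ := hQ.exists_mem_Ioc (by exact_mod_cast hT) t 0
  rw [hty]
  exact h y (by simp at hy ⊢; omega)

theorem sum_Icc_sub_one {T : ℕ} (hT : 0 < T) {f : ℤ → ℝ} (hf : ∀ t, f (t + T) = f t) :
    ∑ t ∈ Finset.Icc (1 : ℤ) T, f (t - 1) = ∑ t ∈ Finset.Icc (1 : ℤ) T, f t := by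
  have h1 : ∑ t ∈ Finset.Icc (1 : ℤ) T, f (t - 1) = ∑ t ∈ Finset.Ico (0 : ℤ) T, f t := by
    refine Finset.sum_bij' (fun t _ => t - 1) (fun t _ => t + 1) ?_ ?_ ?_ ?_ ?_ <;> simp
  have h0 : Finset.Ico (0 : ℤ) T = insert 0 (Finset.Ico (1 : ℤ) T) := by
    ext t; simp; omega
  have h2 : Finset.Icc (1 : ℤ) T = insert (T : ℤ) (Finset.Ico (1 : ℤ) T) := by
    ext t; simp; omega
  rw [h1, h0, h2, Finset.sum_insert (by simp), Finset.sum_insert (by simp)]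
  simpa using (hf 0).symm

/-- Summation by parts for periodic sequences. -/
theorem sum_inner_delta {N T : ℕ} (hT : 0 < T) {p v : ℤ → Vec N} (hp : ∀ t, p (t + T) = p t)
    (hv : ∀ t, v (t + T) = v t) :
    ∑ t ∈ Finset.Icc (1 : ℤ) T, inner ℝ (p t) (delta v t) =
      -∑ t ∈ Finset.Icc (1 : ℤ) T, inner ℝ (delta (fun τ => p (τ - 1)) t) (v t) := by
  have h := sum_Icc_sub_one hT (f := fun t => inner ℝ (p t) (v (t + 1))) (fun t => by
    rw [hp, add_right_comm, hv])
  simp only [sub_add_cancel] at h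
  simp only [delta, inner_sub_right, inner_sub_left, add_sub_cancel_right,
    Finset.sum_sub_distrib]
  rw [h]
  ring

theorem finiteDimensional_ET {N T : ℕ} (hT : 0 < T) : FiniteDimensional ℝ (ET N T) := by
  let L : ET N T →ₗ[ℝ] (Finset.Icc (1 : ℤ) T → Vec N) :=
    (LinearMap.funLeft ℝ (Vec N) (Subtype.val : Finset.Icc (1 : ℤ) T → ℤ)).comp (ET N T).subtype
  refine FiniteDimensional.of_injective L ((injective_iff_map_eq_zero L).2 fun u hu => ?_)
  refine Subtype.ext (funext fun t => ?_)
  refine forall_of_forall_mem_Icc hT (Q := fun t => (u : ℤ → Vec N) t = 0)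
    (fun t => by rw [u.2 t]) (fun t ht => ?_) t
  exact congrFun hu ⟨t, ht⟩

variable {N T : ℕ}

/-- Evaluation of the two components of `u ∈ E` at time `t`. -/
def evalE (t : ℤ) : E N T →L[ℝ] Vec N × Vec N :=
  (((ContinuousLinearMap.proj t).comp (ET N T).subtypeL).comp
    (ContinuousLinearMap.fst ℝ (ET N T) (ET N T))).prod
  (((ContinuousLinearMap.proj t).comp (ET N T).subtypeL).comp
    (ContinuousLinearMap.snd ℝ (ET N T) (ET N T)))

theorem evalE_apply (t : ℤ) (u : E N T) : evalE t u = (E.fst u t, E.snd u t) := rfl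

theorem E_ext (hT : 0 < T) {u v : E N T}
    (h : ∀ t ∈ Finset.Icc (1 : ℤ) T, evalE t u = evalE t v) : u = v := by
  have key : ∀ t, evalE t u = evalE t v :=
    forall_of_forall_mem_Icc hT (fun t => by
      simp only [evalE_apply, E.fst, E.snd, u.1.2 t, u.2.2 t, v.1.2 t, v.2.2 t]) h
  exact Prod.ext (Subtype.ext (funext fun t => congrArg Prod.fst (key t)))
    (Subtype.ext (funext fun t => congrArg Prod.snd (key t)))

theorem delta_add_smul (h k : ℤ → Vec N) (s : ℝ) (t : ℤ) :
    delta (fun τ => h τ + s • k τ) t = delta h t + s • delta k t := by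
  simp only [delta, smul_sub]
  abel

theorem hasDerivAt_comp_line {Y : Type*} [NormedAddCommGroup Y] [NormedSpace ℝ Y] {f : Y → ℝ}
    {f' : Y →L[ℝ] ℝ} {x : Y} (hf : HasFDerivAt f f' x) (v : Y) :
    HasDerivAt (fun s : ℝ => f (x + s • v)) (f' v) 0 := by
  have h : HasDerivAt (fun s : ℝ => x + s • v) v 0 := by
    simpa using ((hasDerivAt_id (0 : ℝ)).smul_const v).const_add x
  have hf' : HasFDerivAt f f' (x + (0 : ℝ) • v) := by simpa using hf
  exact hf'.comp_hasDerivAt 0 h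

theorem hasDerivAt_funI {ρ : Fin 4 → ℤ → ℝ} {φ : Fin 4 → Vec N → Vec N} {Φ : Fin 4 → Vec N → ℝ}
    (hΦ : ∀ i x, HasGradientAt (Φ i) (φ i x) x) (u v : E N T) :
    HasDerivAt (fun s : ℝ => funI ρ Φ (u + s • v))
      (∑ t ∈ Finset.Icc (1 : ℤ) T,
        (ρ 0 t * inner ℝ (φ 0 (delta (E.fst u) t)) (delta (E.fst v) t)
          + ρ 1 t * inner ℝ (φ 1 (delta (E.snd u) t)) (delta (E.snd v) t)
          + ρ 2 t * inner ℝ (φ 2 (E.fst u t)) (E.fst v t)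
          + ρ 3 t * inner ℝ (φ 3 (E.snd u t)) (E.snd v t))) 0 := by
  have hline : ∀ i x w, HasDerivAt (fun s : ℝ => Φ i (x + s • w)) (inner ℝ (φ i x) w) 0 :=
    fun i x w => hasDerivAt_comp_line (hΦ i x).hasFDerivAt w
  have h1 : ∀ s : ℝ, E.fst (u + s • v) = fun t => E.fst u t + s • E.fst v t := fun s => rfl
  have h2 : ∀ s : ℝ, E.snd (u + s • v) = fun t => E.snd u t + s • E.snd v t := fun s => rfl
  simp only [funI, h1, h2, delta_add_smul]
  refine HasDerivAt.fun_sum fun t _ => ?_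
  exact ((((hline 0 _ _).const_mul _).add ((hline 1 _ _).const_mul _)).add
    ((hline 2 _ _).const_mul _)).add ((hline 3 _ _).const_mul _)

/-- The product carries the sup norm and hence no gradient of `K`; the chain rule in each slot
replaces it by the two partial gradients. -/
theorem fderiv_eq_inner_gradient {K : Vec N × Vec N → ℝ} {p : Vec N × Vec N}
    (hK : DifferentiableAt ℝ K p) (v : Vec N × Vec N) :
    fderiv ℝ K p v = inner ℝ (gradient (fun x => K (x, p.2)) p.1) v.1
      + inner ℝ (gradient (fun x => K (p.1, x)) p.2) v.2 := by
  have h1 : HasFDerivAt (fun x => K (x, p.2)) _ p.1 :=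
    HasFDerivAt.comp p.1 (f := fun x => (x, p.2)) (g := K) hK.hasFDerivAt
      (hasFDerivAt_prodMk_left p.1 p.2)
  have h2 : HasFDerivAt (fun x => K (p.1, x)) _ p.2 :=
    HasFDerivAt.comp p.2 (f := fun x => (p.1, x)) (g := K) hK.hasFDerivAt
      (hasFDerivAt_prodMk_right p.1 p.2)
  rw [gradient, gradient, InnerProductSpace.toDual_symm_apply,
    InnerProductSpace.toDual_symm_apply, h1.fderiv, h2.fderiv]
  simp [← map_add]

theorem hasDerivAt_sumFun {W : ℤ → Vec N → Vec N → ℝ} (hW : IsPeriodicC1 T W) (u v : E N T) :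
    HasDerivAt (fun s : ℝ => sumFun W (u + s • v))
      (∑ t ∈ Finset.Icc (1 : ℤ) T,
        (inner ℝ (gradient (fun x => W t x (E.snd u t)) (E.fst u t)) (E.fst v t)
          + inner ℝ (gradient (fun x => W t (E.fst u t) x) (E.snd u t)) (E.snd v t))) 0 := by
  refine HasDerivAt.fun_sum fun t ht => ?_
  have hd := ((hW.2 t ht).differentiable one_ne_zero) (E.fst u t, E.snd u t)
  have h := hasDerivAt_comp_line hd.hasFDerivAt (E.fst v t, E.snd v t)
  rw [fderiv_eq_inner_gradient hd] at h
  exact h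

theorem IsPeriodicC1.potW {F G H : ℤ → Vec N → Vec N → ℝ} (hF : IsPeriodicC1 T F)
    (hG : IsPeriodicC1 T G) (hH : IsPeriodicC1 T H) (lam nu : ℝ) :
    IsPeriodicC1 T (potW F G H lam nu) :=
  ⟨fun t x y => by simp only [DiffSystem.potW, hF.1, hG.1, hH.1],
    fun t ht => ((hF.2 t ht).sub (contDiff_const.mul (hG.2 t ht))).add
      (contDiff_const.mul (hH.2 t ht))⟩

/-- Critical points of the action functional are solutions of the difference system. -/
theorem isSolution_of_critical (hT : 0 < T) {mu : ℝ} {ρ : Fin 4 → ℤ → ℝ}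
    {φ : Fin 4 → Vec N → Vec N} {Φ : Fin 4 → Vec N → ℝ} {W : ℤ → Vec N → Vec N → ℝ}
    (hρ : ∀ i t, ρ i (t + T) = ρ i t) (hΦ : ∀ i x, HasGradientAt (Φ i) (φ i x) x)
    (hW : IsPeriodicC1 T W) {u : E N T}
    (hu : ∀ v : E N T,
      HasDerivAt (fun s : ℝ => mu * funI ρ Φ (u + s • v) - sumFun W (u + s • v)) 0 0) :
    IsSolution mu ρ φ W u := by
  have hu1 : ∀ t, E.fst u (t + T) = E.fst u t := u.1.2
  have hu2 : ∀ t, E.snd u (t + T) = E.snd u t := u.2.2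
  have hd : ∀ {h : ℤ → Vec N}, (∀ t, h (t + T) = h t) → ∀ t, delta h (t + T) = delta h t :=
    fun {h} hh t => by rw [delta, delta, add_right_comm, hh, hh]
  set p : ℤ → Vec N := fun t => ρ 0 t • φ 0 (delta (E.fst u) t) with hp
  set q : ℤ → Vec N := fun t => ρ 1 t • φ 1 (delta (E.snd u) t) with hq
  have hpp : ∀ t, p (t + T) = p t := fun t => by simp only [hp, hρ, hd hu1]
  have hqp : ∀ t, q (t + T) = q t := fun t => by simp only [hq, hρ, hd hu2]
  have hsh : ∀ {h : ℤ → Vec N}, (∀ t, h (t + T) = h t) → ∀ t, h (t + T - 1) = h (t - 1) :=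
    fun {h} hh t => by rw [add_sub_right_comm, hh]
  set A : ℤ → Vec N := fun t => mu • delta (fun τ => p (τ - 1)) t
    - (mu * ρ 2 t) • φ 2 (E.fst u t) + gradient (fun x => W t x (E.snd u t)) (E.fst u t) with hA
  set B : ℤ → Vec N := fun t => mu • delta (fun τ => q (τ - 1)) t
    - (mu * ρ 3 t) • φ 3 (E.snd u t) + gradient (fun x => W t (E.fst u t) x) (E.snd u t) with hB
  have hAp : ∀ t, A (t + T) = A t := fun t => by
    simp only [hA, hd (h := fun τ => p (τ - 1)) (hsh hpp), hρ, hu1, hu2, hW.1]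
  have hBp : ∀ t, B (t + T) = B t := fun t => by
    simp only [hB, hd (h := fun τ => q (τ - 1)) (hsh hqp), hρ, hu1, hu2, hW.1]
  -- The test direction is the residual of the system itself, which is periodic; the derivative
  -- along it is `-∑ (‖A t‖² + ‖B t‖²)`.
  let v : E N T := (⟨A, hAp⟩, ⟨B, hBp⟩)
  have hv1 : E.fst v = A := rfl
  have hv2 : E.snd v = B := rfl
  have hder := (hu v).unique (((hasDerivAt_funI hΦ u v).const_mul mu).sub (hasDerivAt_sumFun hW u v))
  have hpA := sum_inner_delta hT hpp hAp
  have hqB := sum_inner_delta hT hqp hBp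
  have hsum : ∑ t ∈ Finset.Icc (1 : ℤ) T, (‖A t‖ ^ 2 + ‖B t‖ ^ 2) = 0 := by
    have e1 : ∀ t, ‖A t‖ ^ 2 = mu * inner ℝ (delta (fun τ => p (τ - 1)) t) (A t)
        - mu * (ρ 2 t * inner ℝ (φ 2 (E.fst u t)) (A t))
        + inner ℝ (gradient (fun x => W t x (E.snd u t)) (E.fst u t)) (A t) := fun t => by
      rw [← real_inner_self_eq_norm_sq]
      nth_rewrite 1 [hA]
      simp only [inner_add_left, inner_sub_left, real_inner_smul_left]
      ring
    have e2 : ∀ t, ‖B t‖ ^ 2 = mu * inner ℝ (delta (fun τ => q (τ - 1)) t) (B t)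
        - mu * (ρ 3 t * inner ℝ (φ 3 (E.snd u t)) (B t))
        + inner ℝ (gradient (fun x => W t (E.fst u t) x) (E.snd u t)) (B t) := fun t => by
      rw [← real_inner_self_eq_norm_sq]
      nth_rewrite 1 [hB]
      simp only [inner_add_left, inner_sub_left, real_inner_smul_left]
      ring
    simp only [e1, e2]
    simp only [hv1, hv2, Finset.sum_add_distrib, Finset.sum_sub_distrib, ← Finset.mul_sum] at hder ⊢
    simp only [hp, hq, real_inner_smul_left] at hpA hqB
    rw [hpA, hqB] at hder
    linarith
  have hzero : ∀ t, A t = 0 ∧ B t = 0 := by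
    refine forall_of_forall_mem_Icc hT (fun t => by rw [hAp, hBp]) fun t ht => ?_
    have h := (Finset.sum_eq_zero_iff_of_nonneg (fun t _ => by positivity)).1 hsum t ht
    have hA0 : ‖A t‖ ^ 2 = 0 := by nlinarith [sq_nonneg ‖A t‖, sq_nonneg ‖B t‖]
    have hB0 : ‖B t‖ ^ 2 = 0 := by nlinarith [sq_nonneg ‖A t‖, sq_nonneg ‖B t‖]
    exact ⟨by simpa using hA0, by simpa using hB0⟩
  exact hzero

/-! ### Coercivity from the growth conditions -/

theorem cobounded_le_pairInfty (N : ℕ) : cobounded (Vec N × Vec N) ≤ pairInfty N := by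
  refine tendsto_iff_comap.1 (tendsto_atTop_mono (fun p => ?_) tendsto_norm_cobounded_atTop)
  exact max_le (le_add_of_nonneg_right (norm_nonneg _)) (le_add_of_nonneg_left (norm_nonneg _))

/-- The larger of the two norms is at least their mean. -/
theorem tendsto_norm_rpow_add_norm_rpow_pairInfty (N : ℕ) {s : ℝ} (hs : 0 < s) :
    Tendsto (fun p : Vec N × Vec N => ‖p.1‖ ^ s + ‖p.2‖ ^ s) (pairInfty N) atTop := by
  have h : Tendsto (fun p : Vec N × Vec N => ((‖p.1‖ + ‖p.2‖) / 2) ^ s) (pairInfty N) atTop :=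
    (tendsto_rpow_atTop hs).comp (tendsto_comap.atTop_div_const two_pos)
  refine tendsto_atTop_mono (fun p => ?_) h
  have h1 : 0 ≤ ‖p.1‖ ^ s := by positivity
  have h2 : 0 ≤ ‖p.2‖ ^ s := by positivity
  rcases le_total ‖p.1‖ ‖p.2‖ with hle | hle
  · have : ((‖p.1‖ + ‖p.2‖) / 2) ^ s ≤ ‖p.2‖ ^ s :=
      Real.rpow_le_rpow (by positivity) (by linarith) hs.le
    linarith
  · have : ((‖p.1‖ + ‖p.2‖) / 2) ^ s ≤ ‖p.1‖ ^ s :=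
      Real.rpow_le_rpow (by positivity) (by linarith) hs.le
    linarith

/-- If `F` has growth at most of order `s` and `G` grows faster than order `s`, then `λ G - F` is
coercive for every `λ > 0`. -/
theorem tendsto_mul_sub_cobounded {N : ℕ} {F G : Vec N × Vec N → ℝ} {s lam : ℝ} (hs : 0 < s)
    (hlam : 0 < lam)
    (hF : limsup (fun p => ((F p / (‖p.1‖ ^ s + ‖p.2‖ ^ s) : ℝ) : EReal)) (pairInfty N) < ⊤)
    (hG : Tendsto (fun p => G p / (‖p.1‖ ^ s + ‖p.2‖ ^ s)) (pairInfty N) atTop) :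
    Tendsto (fun p => lam * G p - F p) (cobounded (Vec N × Vec N)) atTop := by
  have hD := tendsto_norm_rpow_add_norm_rpow_pairInfty N hs
  -- Eventually `F < C D` and `λ G ≥ (C + 1) D`, where `D` is the sum of the `s`-th powers, so `λ G
  -- - F ≥ D`.
  obtain ⟨C, hC, -⟩ := EReal.lt_iff_exists_real_btwn.1 hF
  refine (tendsto_atTop_mono' _ ?_ hD).mono_left (cobounded_le_pairInfty N)
  filter_upwards [eventually_lt_of_limsup_lt hC, hG.eventually_ge_atTop ((C + 1) / lam),
    hD.eventually_gt_atTop 0] with p h1 h2 h3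
  rw [EReal.coe_lt_coe_iff, div_lt_iff₀ h3] at h1
  rw [div_le_iff₀ hlam, ← mul_div_right_comm, le_div_iff₀ h3] at h2
  linarith

/-! ### The functionals in Euclidean coordinates -/

section Coordinates

variable {X : Type*} [NormedAddCommGroup X] [NormedSpace ℝ X] (e : X ≃L[ℝ] E N T)

theorem contDiff_fst_apply (t : ℤ) : ContDiff ℝ 1 fun x => E.fst (e x) t :=
  ((ContinuousLinearMap.fst ℝ _ _).comp ((evalE t).comp e.toContinuousLinearMap)).contDiff

theorem contDiff_snd_apply (t : ℤ) : ContDiff ℝ 1 fun x => E.snd (e x) t :=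
  ((ContinuousLinearMap.snd ℝ _ _).comp ((evalE t).comp e.toContinuousLinearMap)).contDiff

theorem contDiff_sumFun {K : ℤ → Vec N → Vec N → ℝ} (hK : IsPeriodicC1 T K) :
    ContDiff ℝ 1 fun x => sumFun K (e x) :=
  ContDiff.sum fun t ht => (hK.2 t ht).comp ((contDiff_fst_apply e t).prodMk (contDiff_snd_apply e t))

theorem contDiff_funI {ρ : Fin 4 → ℤ → ℝ} {Φ : Fin 4 → Vec N → ℝ}
    (hΦ : ∀ i, ContDiff ℝ 1 (Φ i)) : ContDiff ℝ 1 fun x => funI ρ Φ (e x) := by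
  have h1 := contDiff_fst_apply e
  have h2 := contDiff_snd_apply e
  refine ContDiff.sum fun t _ => ?_
  exact (((contDiff_const.mul ((hΦ 0).comp ((h1 (t + 1)).sub (h1 t)))).add
    (contDiff_const.mul ((hΦ 1).comp ((h2 (t + 1)).sub (h2 t))))).add
    (contDiff_const.mul ((hΦ 2).comp (h1 t)))).add (contDiff_const.mul ((hΦ 3).comp (h2 t)))

/-- Turns a bound on the Euclidean norm of the coordinates into a bound on `normE`, by compactness
of balls. -/
theorem continuous_normE {θ : ℝ} (hθ : 0 ≤ θ) : Continuous fun x => normE θ (e x) := by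
  have h1 := fun t => (contDiff_fst_apply e t).continuous
  have h2 := fun t => (contDiff_snd_apply e t).continuous
  have key : ∀ {h : X → ℤ → Vec N}, (∀ t, Continuous fun x => h x t) →
      Continuous fun x => normET T θ (h x) := fun {h} hh => by
    refine Continuous.rpow_const (Continuous.add ?_ ?_) fun _ => Or.inr (by positivity)
    · exact continuous_finsetSum _ fun t _ =>
        ((hh (t + 1)).sub (hh t)).norm.rpow_const fun _ => Or.inr hθ
    · exact continuous_finsetSum _ fun t _ => (hh t).norm.rpow_const fun _ => Or.inr hθ
  exact (key h1).add (key h2)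

/-- Evaluation over one period is linear and injective, so it sends unbounded sets of coordinates to
unbounded values, where the sum is coercive. -/
theorem tendsto_sumFun_cobounded [FiniteDimensional ℝ X] (hT : 0 < T)
    {K : ℤ → Vec N → Vec N → ℝ}
    (hK : ∀ t ∈ Finset.Icc (1 : ℤ) T, Continuous fun p : Vec N × Vec N => K t p.1 p.2)
    (hco : ∀ t ∈ Finset.Icc (1 : ℤ) T,
      Tendsto (fun p : Vec N × Vec N => K t p.1 p.2) (cobounded _) atTop) :
    Tendsto (fun x => sumFun K (e x)) (cobounded X) atTop := by
  let L : X →ₗ[ℝ] (Finset.Icc (1 : ℤ) T → Vec N × Vec N) :=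
    LinearMap.pi fun t => ((evalE (t : ℤ)).comp e.toContinuousLinearMap).toLinearMap
  have hL : Function.Injective L := fun x y hxy =>
    e.injective (E_ext hT fun t ht => congrFun hxy ⟨t, ht⟩)
  have h := (tendsto_sum_pi_cobounded (fun t : Finset.Icc (1 : ℤ) T => hK t t.2)
    (fun t => hco t t.2)).comp (L.tendsto_cobounded_of_injective hL)
  refine h.congr fun x => ?_
  exact Finset.sum_coe_sort (Finset.Icc (1 : ℤ) T)
    (fun t => K t (E.fst (e x) t) (E.snd (e x) t))

end Coordinates

/-! ### What the conditions on `μ*` and `β` provide -/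

theorem sumFun_potW (F G H : ℤ → Vec N → Vec N → ℝ) (lam nu : ℝ) (u : E N T) :
    sumFun (potW F G H lam nu) u = sumFun F u - lam * sumFun G u + nu * sumFun H u := by
  simp only [sumFun, potW, Finset.sum_add_distrib, Finset.sum_sub_distrib, Finset.mul_sum]

theorem funI_nonneg {ρ : Fin 4 → ℤ → ℝ} {Φ : Fin 4 → Vec N → ℝ}
    (hρ : ∀ i, ∀ t ∈ Finset.Icc (1 : ℤ) T, 0 < ρ i t) (hΦ : ∀ i x, 0 ≤ Φ i x) (u : E N T) :
    0 ≤ funI ρ Φ u :=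
  Finset.sum_nonneg fun t ht => by
    have h := fun i x => mul_nonneg (hρ i t ht).le (hΦ i x)
    exact add_nonneg (add_nonneg (add_nonneg (h 0 _) (h 1 _)) (h 2 _)) (h 3 _)

/-- If `μ > μ*(I, Ψ, Φ, r)`, then `μ I + Ψ` takes in `Φ < r` a value below its values on
`Φ = r`. -/
theorem exists_lt_of_muStar_lt {X : Type*} {I Ψ Φ : X → ℝ} {r mu : ℝ} (hmu : 0 ≤ mu)
    (hI : ∀ u, 0 ≤ I u) (hΨΦ : BddBelow (Set.range fun u => Ψ u + Φ u))
    (h : muStar I Ψ Φ r < (mu : EReal)) :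
    ∃ u κ, Φ u < r ∧ mu * I u + Ψ u < κ ∧ ∀ v, Φ v = r → κ ≤ mu * I v + Ψ v := by
  simp only [muStar, iInf_lt_iff] at h
  obtain ⟨u, ⟨hu, hIu⟩, hlt⟩ := h
  rw [EReal.coe_lt_coe_iff, div_lt_iff₀ (sub_pos.2 hIu)] at hlt
  -- On `Φ = r` one has `I ≥ η_r` and `Ψ ≥ γ - r`.
  refine ⟨u, mu * etaInf I Φ r + gammaInf Ψ Φ - r, hu, by linarith, fun v hv => ?_⟩
  have h1 : etaInf I Φ r ≤ I v :=
    csInf_le ⟨0, by rintro _ ⟨w, -, rfl⟩; exact hI w⟩ ⟨v, hv, rfl⟩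
  have h2 : gammaInf Ψ Φ ≤ Ψ v + Φ v := csInf_le hΨΦ ⟨v, rfl⟩
  have h3 := mul_le_mul_of_nonneg_left h1 hmu
  linarith

/-- If `b < β(J, Φ, r)`, then `J + b Φ` takes in `Φ > r` a value below `inf_{Φ ≤ r} J + b r`. -/
theorem exists_lt_of_lt_beta {X : Type*} {J Φ : X → ℝ} {r b : ℝ} (h : (b : EReal) < beta J Φ r) :
    ∃ u, r < Φ u ∧ J u + b * Φ u < sInf (J '' {v | Φ v ≤ r}) + b * r := by
  simp only [beta, lt_iSup_iff] at h
  obtain ⟨u, hu, hlt⟩ := h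
  have hu' : r - Φ u < 0 := sub_neg.2 hu
  rw [EReal.coe_lt_coe_iff, lt_div_iff_of_neg hu'] at hlt
  exact ⟨u, hu, by linarith⟩

end DiffSystem

open DiffSystem

/-! ### Assembly -/

theorem corollary1p1 (N T : ℕ) (hN : 0 < N) (hT : 1 < T)
    (ρ : Fin 4 → ℤ → ℝ) (φ : Fin 4 → DiffSystem.Vec N → DiffSystem.Vec N)
    (Φ : Fin 4 → DiffSystem.Vec N → ℝ)
    (F G H : ℤ → DiffSystem.Vec N → DiffSystem.Vec N → ℝ)
    (θ l s : ℝ)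
    (hρ_per : ∀ i t, ρ i (t + T) = ρ i t)
    (hρ_pos : ∀ i, ∀ t ∈ Finset.Icc (1 : ℤ) T, 0 < ρ i t)
    (hA1 : ∀ i, DiffSystem.IsClassicalHomeo (φ i) (Φ i))
    (hF : DiffSystem.IsPeriodicC1 T F) (hG : DiffSystem.IsPeriodicC1 T G)
    (hH : DiffSystem.IsPeriodicC1 T H)
    (hθ : 1 < θ)
    (hA3 : ∃ c : Fin 4 → ℝ, (∀ i, 0 < c i) ∧
      ∀ i x y, c i * ‖x - y‖ ^ θ ≤ inner ℝ (φ i x - φ i y) (x - y))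
    (hl : θ ≤ l)
    (hA4_lim : ∀ i, Filter.Tendsto (Φ i) (Bornology.cobounded (DiffSystem.Vec N)) Filter.atTop)
    (hA4_growth : ∃ d m : Fin 4 → ℝ, (∀ i, 0 < d i) ∧ (∀ i, 0 < m i) ∧
      ∀ i x, Φ i x ≤ d i * ‖x‖ ^ l + m i)
    (hs : l < s)
    (hA5_F_lower : ∀ t ∈ Finset.Icc (1 : ℤ) T,
      Filter.Tendsto (fun p => F t p.1 p.2 / (‖p.1‖ ^ l + ‖p.2‖ ^ l))
        (DiffSystem.pairInfty N) Filter.atTop)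
    (hA5_F_upper : ∀ t ∈ Finset.Icc (1 : ℤ) T,
      Filter.limsup (fun p => ((F t p.1 p.2 / (‖p.1‖ ^ s + ‖p.2‖ ^ s) : ℝ) : EReal))
        (DiffSystem.pairInfty N) < ⊤)
    (hA5_G : ∀ t ∈ Finset.Icc (1 : ℤ) T,
      Filter.Tendsto (fun p => G t p.1 p.2 / (‖p.1‖ ^ s + ‖p.2‖ ^ s))
        (DiffSystem.pairInfty N) Filter.atTop)
    (hA6 : ∑ t ∈ Finset.Icc (1 : ℤ) T, G t 0 0 = 0) :
    ∀ r : ℝ, 0 < r →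
    ∀ mu : ℝ,
      max 0 (DiffSystem.muStar (DiffSystem.funI (T := T) ρ Φ) (DiffSystem.funPsi F)
        (DiffSystem.funPhi G) r) < (mu : EReal) →
    ∀ a b : ℝ, 0 < a → a ≤ b →
      (b : EReal) < DiffSystem.beta
        (fun u : DiffSystem.E N T => mu * DiffSystem.funI ρ Φ u + DiffSystem.funPsi F u)
        (DiffSystem.funPhi G) r →
    ∃ R : ℝ, 0 < R ∧
      ∀ lam ∈ Set.Icc a b, ∃ δ : ℝ, 0 < δ ∧
        ∀ nu ∈ Set.Icc 0 δ,
          ∃ u : Fin 3 → DiffSystem.E N T, Function.Injective u ∧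
            ∀ k, DiffSystem.IsSolution mu ρ φ (DiffSystem.potW F G H lam nu) (u k) ∧
              DiffSystem.normE θ (u k) < R := by
  intro r _ mu hmu a b ha hab hb
  have hT0 : 0 < T := by omega
  have hs0 : 0 < s := by linarith
  obtain ⟨hmu0, hmuStar⟩ := max_lt_iff.1 hmu
  rw [EReal.coe_pos] at hmu0
  have : FiniteDimensional ℝ (ET N T) := finiteDimensional_ET hT0
  -- `E` inherits only the product topology of sequences; Euclidean coordinates supply the inner
  -- product needed for gradients.
  let e : EuclideanSpace ℝ (Fin (Module.finrank ℝ (E N T))) ≃L[ℝ] E N T := toEuclidean.symm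
  have hI0 : ∀ u : E N T, 0 ≤ funI ρ Φ u := funI_nonneg hρ_pos fun i => (hA1 i).nonneg
  have hJ : ContDiff ℝ 1 fun x => mu * funI ρ Φ (e x) + funPsi F (e x) :=
    (contDiff_const.mul (contDiff_funI e fun i => (hA1 i).contDiff)).add (contDiff_sumFun e hF).neg
  have hP : ContDiff ℝ 1 fun x => funPhi G (e x) := contDiff_sumFun e hG
  have hK : ContDiff ℝ 1 fun x => -sumFun H (e x) := (contDiff_sumFun e hH).neg
  have hcoΨ : ∀ lam : ℝ, 0 < lam → Tendsto (fun x => funPsi F (e x) + lam * funPhi G (e x))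
      (cobounded _) atTop := fun lam hlam => by
    refine (tendsto_sumFun_cobounded e hT0 (K := fun t x y => lam * G t x y - F t x y)
      (fun t ht => ((contDiff_const.mul (hG.2 t ht)).sub (hF.2 t ht)).continuous)
      (fun t ht => tendsto_mul_sub_cobounded hs0 hlam (hA5_F_upper t ht) (hA5_G t ht))).congr
      fun x => ?_
    simp only [funPsi, funPhi, sumFun, Finset.sum_sub_distrib, Finset.mul_sum]
    ring
  have hco : ∀ lam : ℝ, 0 < lam → Tendsto
      (fun x => mu * funI ρ Φ (e x) + funPsi F (e x) + lam * funPhi G (e x))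
      (cobounded _) atTop := fun lam hlam =>
    tendsto_atTop_mono (fun x => by linarith [mul_nonneg hmu0.le (hI0 (e x))]) (hcoΨ lam hlam)
  -- Without boundedness below, the real `sInf` defining `γ` would take its default value 0;
  -- coercivity at `λ = 1` rules this out.
  have hbdd : BddBelow (Set.range fun u : E N T => funPsi F u + funPhi G u) := by
    obtain ⟨c, hc⟩ := exists_forall_le_of_tendsto_cobounded
      ((contDiff_sumFun e hF).neg.add (contDiff_const.mul hP)).continuous (hcoΨ 1 one_pos)
    refine ⟨c, ?_⟩
    rintro _ ⟨u, rfl⟩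
    obtain ⟨x, rfl⟩ := e.surjective u
    have := hc x
    rwa [one_mul] at this
  obtain ⟨u₀, κ, hu₀, hJu₀, hκ⟩ := exists_lt_of_muStar_lt hmu0.le hI0 hbdd hmuStar
  obtain ⟨u₁, hu₁, hJu₁⟩ := exists_lt_of_lt_beta hb
  have hm : ∀ u : E N T, funPhi G u ≤ r →
      sInf ((fun u : E N T => mu * funI ρ Φ u + funPsi F u) '' {v | funPhi G v ≤ r}) ≤
        mu * funI ρ Φ u + funPsi F u := by
    obtain ⟨c, hc⟩ := exists_forall_le_of_tendsto_cobounded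
      (hJ.add (contDiff_const.mul hP)).continuous (hco a ha)
    -- `J + a P ≥ c` and `P ≤ r` give `J ≥ c - a r`, so the infimum inside `β` is genuine.
    refine fun u hu => csInf_le ⟨c - a * r, ?_⟩ ⟨u, hu, rfl⟩
    rintro _ ⟨v, hv, rfl⟩
    obtain ⟨x, rfl⟩ := e.surjective v
    have h1 := hc x
    have h2 := mul_le_mul_of_nonneg_left (show funPhi G (e x) ≤ r from hv) ha.le
    show c - a * r ≤ mu * funI ρ Φ (e x) + funPsi F (e x)
    linarith
  obtain ⟨x₀, rfl⟩ := e.surjective u₀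
  obtain ⟨x₁, rfl⟩ := e.surjective u₁
  obtain ⟨R, -, hR⟩ := exists_bound_three_critical_points hJ hP hK ha (hco a ha)
    (hco b (ha.trans_le hab)) (fun x => hκ (e x)) (fun x => hm (e x)) hu₀ hJu₀ hu₁ hJu₁
  obtain ⟨M, hM⟩ := (isCompact_closedBall (0 : EuclideanSpace ℝ
    (Fin (Module.finrank ℝ (E N T)))) R).exists_bound_of_continuousOn
    (continuous_normE e (θ := θ) (by linarith)).continuousOn
  refine ⟨|M| + 1, by positivity, fun lam hlam => ?_⟩
  obtain ⟨δ, hδ, hsol⟩ := hR lam hlam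
  refine ⟨δ, hδ, fun nu hnu => ?_⟩
  obtain ⟨x, hinj, hx⟩ := hsol nu hnu
  refine ⟨fun k => e (x k), e.injective.comp hinj, fun k => ⟨?_, ?_⟩⟩
  · refine isSolution_of_critical hT0 hρ_per (fun i => (hA1 i).grad) (hF.potW hG hH lam nu)
      fun v => ?_
    have hd := ((hJ.add ((contDiff_const (c := lam)).mul hP)).add
      ((contDiff_const (c := nu)).mul hK)).differentiable one_ne_zero (x k)
    have hline := hasDerivAt_comp_line hd.hasGradientAt.hasFDerivAt (e.symm v)
    rw [(hx k).1, map_zero, zero_apply] at hline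
    refine hline.congr_of_eventuallyEq (Eventually.of_forall fun σ => ?_)
    simp only [map_add, map_smul, e.apply_symm_apply, sumFun_potW, funPsi, funPhi]
    ring
  · have h1 := hM (x k) (by simpa using (hx k).2.le)
    linarith [(le_abs_self _).trans h1, le_abs_self M]
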